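/- Let $N$ be a positive integer. Let $P_{2N}$ be the set of primes $p < 2N-2$ that do not divide $2N$, and let $X_{2N}$ be the set of composite integers $m < 2N-2$ all of whose prime factors belong to $P_{2N}$. If $2N \ge 3\times 10^{6}$, then $$\operatorname{card} X_{2N} > \operatorname{card} P_{2N}.$$ -/

import Mathlib

namespace Goldbach

/-- `p` is a prime of type P related to `n`: a prime less than `n - 2` that does not divide `n`. -/
def IsPrimeOfTypeP (n p : ℕ) : Prop :=
  p.Prime ∧ p < n - 2 ∧ ¬ p ∣ n

/-- A composite number: an integer greater than `1` that is not prime. -/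
def IsComposite (m : ℕ) : Prop :=
  1 < m ∧ ¬ m.Prime

/-- `m` is a composite of type P related to `n`: a composite number less than `n - 2`, all of whose
prime factors are primes of type P related to `n`. -/
def IsCompositeOfTypeP (n m : ℕ) : Prop :=
  IsComposite m ∧ m < n - 2 ∧ ∀ p : ℕ, p.Prime → p ∣ m → IsPrimeOfTypeP n p

/-- The set of the primes of type P related to `n`. -/
def primesOfTypeP (n : ℕ) : Set ℕ :=
  {p | IsPrimeOfTypeP n p}

/-- The set of the composites of type P related to `n`. -/
def compositesOfTypeP (n : ℕ) : Set ℕ :=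
  {m | IsCompositeOfTypeP n m}

theorem primesOfTypeP_finite (n : ℕ) : (primesOfTypeP n).Finite :=
  (Set.finite_Iio (n - 2)).subset fun _ hp => hp.2.1

theorem compositesOfTypeP_finite (n : ℕ) : (compositesOfTypeP n).Finite :=
  (Set.finite_Iio (n - 2)).subset fun _ hm => hm.2.1

end Goldbach

/-!
An integer below `n` and coprime to the even number `n` is `1`, `n - 1`, a prime of type P or a
composite of type P. So `φ(n) ≤ card P + card X + 2`, and since `2` is not of type P it suffices
that `2 π(n) < φ(n)` for `n ≥ 3 * 10 ^ 6`. As `φ(n) / n` can be as small as a multiple of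
`1 / log log n` while `π(n) / n` has order `1 / log n`, only the constants matter.

* `Nat.primeCounting_floor_le`: the integer `(6n)! n! / ((3n)! (2n)!²)` is at most `108 ^ n` and is
  divisible by every prime in `(2n, 6n]`. Iterating, `θ(x) ≤ 1.18 x + 1320`, and partial summation
  turns this into `π(x) ≤ 1.18 x / log x + 1.77 x / log² x + 1390`, which is below
  `1.34 x / log x` from `3 * 10 ^ 6` on.
* `Nat.totient_mul_log_ge`: `φ(n) log n ≥ 2.68 n`. If `n` has `k` prime factors, then `φ(n) / n` is
  at least its value at the product of the first `k` primes, and that product is at most `n`. For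
  `k ≤ 7` the value is at least `0.1805`, which is enough because `log n ≥ 14.9`. For `k ≥ 8` the
  quantity `φ(P) / P * log P` is increasing along the products `P` of the first `k` primes, and at
  `k = 8` it already exceeds `2.73`.
-/

open Finset

/-! ### Chebyshev's upper bound with slope `1.18` -/

theorem Nat.div_three_add_two_mul_div_two_le (n m : ℕ) (hm : 0 < m) :
    3 * n / m + 2 * (2 * n / m) ≤ 6 * n / m + n / m := by
  obtain ⟨q, r, hr, rfl⟩ : ∃ q r, r < m ∧ n = m * q + r :=
    ⟨n / m, n % m, Nat.mod_lt _ hm, (Nat.div_add_mod n m).symm⟩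
  have key : ∀ k, k * (m * q + r) / m = k * q + k * r / m := fun k => by
    rw [show k * (m * q + r) = k * r + m * (k * q) by ring, Nat.add_mul_div_left _ _ hm, add_comm]
  have h1 := key 1
  simp only [one_mul] at h1
  rw [key, key, key, h1, Nat.div_eq_of_lt hr]
  have h2 : 2 * r / m < 2 := Nat.div_lt_of_lt_mul (by omega)
  have h3 : 3 * r / m < 3 := Nat.div_lt_of_lt_mul (by omega)
  -- With `x = r / m`, the claim is `⌊3x⌋ + 2 ⌊2x⌋ ≤ ⌊6x⌋` on `[0, 1)`.
  have h4 : 3 * r / m + 2 * (2 * r / m) ≤ 6 * r / m := by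
    rw [Nat.le_div_iff_mul_le hm]
    have e2 := Nat.div_mul_le_self (2 * r) m
    have e3 := Nat.div_mul_le_self (3 * r) m
    generalize 2 * r / m = a at *
    generalize 3 * r / m = b at *
    interval_cases a <;> interval_cases b <;> omega
  omega

/-- By Legendre's formula `(3n)! (2n)!²` divides `(6n)! n!`, and for a prime `p` in `(2n, 6n]` the
first term of the formula leaves a factor `p` to spare in the quotient. -/
theorem Nat.factorization_factorial_three_mul_le (n p : ℕ) (hp : p.Prime) :
    ((3 * n).factorial * (2 * n).factorial ^ 2).factorization p +
      (if 2 * n < p ∧ p ≤ 6 * n then 1 else 0) ≤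
    ((6 * n).factorial * n.factorial).factorization p := by
  have hf := fun k => Nat.factorial_ne_zero k
  rw [Nat.factorization_mul (hf _) (pow_ne_zero _ (hf _)), Nat.factorization_mul (hf _) (hf _),
    Nat.factorization_pow]
  simp only [Finsupp.add_apply, Finsupp.smul_apply, smul_eq_mul]
  set b := Nat.log p (6 * n) + 2
  have hl : ∀ k, k ≤ 6 * n → Nat.log p k < b := fun k hk =>
    (Nat.log_mono_right hk).trans_lt (by omega)
  rw [Nat.factorization_factorial hp (hl (3 * n) (by omega)),
    Nat.factorization_factorial hp (hl (2 * n) (by omega)),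
    Nat.factorization_factorial hp (hl (6 * n) le_rfl),
    Nat.factorization_factorial hp (hl n (by omega)), mul_sum, ← sum_add_distrib,
    ← sum_add_distrib]
  have hle : ∀ i ∈ Ico 1 b, 3 * n / p ^ i + 2 * (2 * n / p ^ i) ≤ 6 * n / p ^ i + n / p ^ i :=
    fun i _ => Nat.div_three_add_two_mul_div_two_le n _ (pow_pos hp.pos i)
  split_ifs with h
  · refine Nat.succ_le_of_lt (sum_lt_sum hle ⟨1, by simp [b], ?_⟩)
    -- For `2n < p ≤ 6n` the term `i = 1` is strict: `⌊3n/p⌋ < ⌊6n/p⌋` and the others vanish.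
    have hp0 := hp.pos
    rw [pow_one, Nat.div_eq_of_lt h.1, Nat.div_eq_of_lt (by omega : n < p)]
    have h3 : 3 * n / p < 2 := Nat.div_lt_of_lt_mul (by omega)
    have : 3 * n / p < 6 * n / p := by
      rw [Nat.lt_iff_add_one_le, Nat.le_div_iff_mul_le hp0]
      have e3 := Nat.div_mul_le_self (3 * n) p
      generalize 3 * n / p = c at *
      interval_cases c <;> omega
    omega
  · simpa using sum_le_sum hle

/-- The base is `108 = 6 ^ 6 / (3 ^ 3 * 2 ^ 4)`, the limiting ratio of consecutive values of
`(6n)! n! / ((3n)! (2n)!²)`. -/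
theorem Nat.factorial_six_mul_mul_factorial_le (n : ℕ) :
    (6 * n).factorial * n.factorial ≤
      (3 * n).factorial * (2 * n).factorial ^ 2 * 108 ^ n := by
  induction n with
  | zero => simp
  | succ n ih =>
    have e6 : (6 * (n + 1)).factorial = (6 * n + 6) * (6 * n + 5) * (6 * n + 4) * (6 * n + 3) *
        (6 * n + 2) * (6 * n + 1) * (6 * n).factorial := by
      rw [show 6 * (n + 1) = 6 * n + 6 by ring]
      simp only [Nat.factorial_succ]; ring
    have e3 : (3 * (n + 1)).factorial = (3 * n + 3) * (3 * n + 2) * (3 * n + 1) *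
        (3 * n).factorial := by
      rw [show 3 * (n + 1) = 3 * n + 3 by ring]
      simp only [Nat.factorial_succ]; ring
    have e2 : (2 * (n + 1)).factorial = (2 * n + 2) * (2 * n + 1) * (2 * n).factorial := by
      rw [show 2 * (n + 1) = 2 * n + 2 by ring]
      simp only [Nat.factorial_succ]; ring
    rw [e6, e3, e2, Nat.factorial_succ n]
    calc _ = (6 * n + 6) * (6 * n + 5) * (6 * n + 4) * (6 * n + 3) * (6 * n + 2) * (6 * n + 1) *
          (n + 1) * ((6 * n).factorial * n.factorial) := by ring
      _ ≤ (108 * ((3 * n + 3) * (3 * n + 2) * (3 * n + 1)) * ((2 * n + 2) * (2 * n + 1)) ^ 2) *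
          ((3 * n).factorial * (2 * n).factorial ^ 2 * 108 ^ n) := by
        refine Nat.mul_le_mul ?_ ih
        calc _ = 24 * ((3 * n + 3) * (3 * n + 2) * (3 * n + 1) * (2 * n + 1) * (n + 1)) *
              ((6 * n + 5) * (6 * n + 1)) := by ring
          _ ≤ 24 * ((3 * n + 3) * (3 * n + 2) * (3 * n + 1) * (2 * n + 1) * (n + 1)) *
              (18 * (2 * n + 1) * (n + 1)) := by
            refine Nat.mul_le_mul_left _ ?_
            nlinarith
          _ = _ := by ring
      _ = _ := by ring

/-- Every prime in `(2n, 6n]` divides the integer `(6n)! n! / ((3n)! (2n)!²)`, which is at most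
`108 ^ n`. -/
theorem primorial_six_mul_le (n : ℕ) : primorial (6 * n) ≤ primorial (2 * n) * 108 ^ n := by
  have hN : (6 * n).factorial * n.factorial ≠ 0 :=
    mul_ne_zero (Nat.factorial_ne_zero _) (Nat.factorial_ne_zero _)
  have hD : (3 * n).factorial * (2 * n).factorial ^ 2 ≠ 0 :=
    mul_ne_zero (Nat.factorial_ne_zero _) (pow_ne_zero _ (Nat.factorial_ne_zero _))
  obtain ⟨M, hM⟩ : (3 * n).factorial * (2 * n).factorial ^ 2 ∣ (6 * n).factorial * n.factorial :=
    (Nat.factorization_prime_le_iff_dvd hD hN).1 fun p hp =>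
      (Nat.le_add_right _ _).trans (Nat.factorization_factorial_three_mul_le n p hp)
  have hM0 : M ≠ 0 := by rintro rfl; exact hN (by simpa using hM)
  have hMle : M ≤ 108 ^ n := by
    have := Nat.factorial_six_mul_mul_factorial_le n
    rw [hM] at this
    exact Nat.le_of_mul_le_mul_left this (Nat.pos_of_ne_zero hD)
  have hdvd : ∏ p ∈ Ioc (2 * n) (6 * n) with p.Prime, p ∣ M := by
    refine prod_primes_dvd _ (fun p hp => (mem_filter.1 hp).2.prime) fun p hp => ?_
    obtain ⟨hp1, hp2⟩ := mem_filter.1 hp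
    have := Nat.factorization_factorial_three_mul_le n p hp2
    rw [if_pos (mem_Ioc.1 hp1), hM, Nat.factorization_mul hD hM0, Finsupp.add_apply] at this
    exact Nat.dvd_of_factorization_pos (by omega)
  have hsplit : primorial (6 * n) =
      primorial (2 * n) * ∏ p ∈ Ioc (2 * n) (6 * n) with p.Prime, p := by
    rw [primorial, primorial, ← prod_union]
    · refine prod_congr ?_ fun _ _ => rfl
      ext p
      simp only [mem_filter, mem_union, mem_range, mem_Ioc]
      grind
    · rw [disjoint_left]
      intro p
      simp only [mem_filter, mem_range, mem_Ioc]
      grind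
  rw [hsplit]
  exact Nat.mul_le_mul_left _ ((Nat.le_of_dvd (Nat.pos_of_ne_zero hM0) hdvd).trans hMle)

theorem Real.log_oneHundredEight_le : Real.log 108 ≤ 4.69 := by
  have h : Real.log (108 ^ 16) ≤ 75 := by
    rw [Real.log_le_iff_le_exp (by norm_num), show (75 : ℝ) = (75 : ℕ) * 1 by norm_num,
      Real.exp_nat_mul]
    exact le_trans (by norm_num) (pow_le_pow_left₀ (by norm_num) Real.exp_one_gt_d9.le 75)
  rw [Real.log_pow] at h
  push_cast at h
  linarith

/-- Strong induction from `n ≈ m / 3` to `m`. The slope `2.36` exceeds `log 108 / 2`, and the excess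
absorbs the rounding of `m / 3` once `m ≥ 472`; below that `primorial k ≤ 4 ^ k` is enough. -/
theorem log_primorial_two_mul_le (m : ℕ) :
    Real.log (primorial (2 * m)) ≤ 2.36 * m + 1315 := by
  induction m using Nat.strong_induction_on with
  | _ m ih =>
  rcases le_or_gt m 471 with hm | hm
  · have h1 := Chebyshev.theta_le_log4_mul_x (x := (2 * m : ℕ)) (by positivity)
    rw [Chebyshev.theta_eq_log_primorial, Nat.floor_natCast,
      show (4 : ℝ) = 2 ^ 2 by norm_num, Real.log_pow] at h1
    have h2 := Real.log_two_lt_d9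
    have h3 : (m : ℝ) ≤ 471 := by exact_mod_cast hm
    push_cast at h1
    nlinarith
  · -- Replace `m` by the least multiple of `3` above it, `3 n`.
    obtain ⟨n, hn1, hn2⟩ : ∃ n, m ≤ 3 * n ∧ 3 * n ≤ m + 2 := ⟨(m + 2) / 3, by omega, by omega⟩
    have h1 : primorial (2 * m) ≤ primorial (2 * n) * 108 ^ n :=
      (primorial_mono (by omega)).trans (primorial_six_mul_le n)
    have h2 : Real.log (primorial (2 * m)) ≤ Real.log (primorial (2 * n)) + n * Real.log 108 := by
      have hpos : (0 : ℝ) < primorial (2 * n) := by exact_mod_cast primorial_pos _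
      rw [← Real.log_pow, ← Real.log_mul hpos.ne' (by positivity)]
      refine Real.log_le_log (by exact_mod_cast primorial_pos _) ?_
      exact_mod_cast h1
    have h3 := ih n (by omega)
    have h4 := Real.log_oneHundredEight_le
    have h5 : (3 * n : ℝ) ≤ m + 2 := by exact_mod_cast hn2
    have h6 : (472 : ℝ) ≤ m := by exact_mod_cast hm
    nlinarith

/-- The slope `1.18` exceeds `log 108 / 4 = 1.1705…`, which is what iterating
`primorial_six_mul_le` gives up to lower order terms. -/
theorem Chebyshev.theta_le_linear {x : ℝ} (hx : 0 ≤ x) : Chebyshev.theta x ≤ 1.18 * x + 1320 := by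
  rw [Chebyshev.theta_eq_log_primorial]
  set k := ⌊x⌋₊
  have hk : (k : ℝ) ≤ x := Nat.floor_le hx
  obtain ⟨m, hm1, hm2⟩ : ∃ m, k ≤ 2 * m ∧ 2 * m ≤ k + 1 := ⟨(k + 1) / 2, by omega, by omega⟩
  have h1 : Real.log (primorial k) ≤ Real.log (primorial (2 * m)) :=
    Real.log_le_log (by exact_mod_cast primorial_pos _) (by exact_mod_cast primorial_mono hm1)
  have h2 := log_primorial_two_mul_le m
  have h3 : (2 * m : ℝ) ≤ k + 1 := by exact_mod_cast hm2
  linarith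

/-! ### An explicit upper bound for the prime counting function -/

theorem Real.exp_six_le : Real.exp 6 ≤ 404 := by
  have h : Real.exp 6 = Real.exp 1 ^ 6 := by rw [← Real.exp_nat_mul]; norm_num
  rw [h]
  exact (pow_le_pow_left₀ (Real.exp_pos _).le Real.exp_one_lt_d9.le _).trans (by norm_num)

theorem Real.two_le_exp_six : 2 ≤ Real.exp 6 := by
  have := Real.add_one_le_exp 6
  linarith

theorem integral_theta_div_exp_six_le :
    ∫ t in (2 : ℝ)..Real.exp 6, Chebyshev.theta t / (t * Real.log t ^ 2) ≤ 1170 := by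
  have hI := Chebyshev.integrableOn_theta_div_id_mul_log_sq (Real.exp 6)
  have h2 := Real.two_le_exp_six
  have hl2 : 0 < Real.log 2 := Real.log_pos (by norm_num)
  -- Since `θ t ≤ t * log 4` and `log 2 ≤ log t`, the integrand is at most `2 / log 2 < 2.9`.
  have hconst : (∫ _t in (2 : ℝ)..Real.exp 6, (2.9 : ℝ)) = 2.9 * (Real.exp 6 - 2) := by
    simp [mul_comm]
  have hmono : ∫ t in (2 : ℝ)..Real.exp 6, Chebyshev.theta t / (t * Real.log t ^ 2) ≤
      ∫ _t in (2 : ℝ)..Real.exp 6, (2.9 : ℝ) := by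
    refine intervalIntegral.integral_mono_on h2 ?_ (by simp) fun t ht => ?_
    · rw [intervalIntegrable_iff_integrableOn_Icc_of_le h2]
      exact hI
    · have ht0 : 0 < t := by linarith [ht.1]
      have hlt : Real.log 2 ≤ Real.log t := Real.log_le_log (by norm_num) ht.1
      have hlt0 : 0 < Real.log t := hl2.trans_le hlt
      have h1 := Chebyshev.theta_le_log4_mul_x ht0.le
      rw [show (4 : ℝ) = 2 ^ 2 by norm_num, Real.log_pow] at h1
      rw [div_le_iff₀ (by positivity)]
      have h3 := Real.log_two_gt_d9
      have h4 : Real.log 2 ^ 2 ≤ Real.log t ^ 2 := by gcongr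
      push_cast at h1
      have h5 : 2 * Real.log 2 ≤ 2.9 * Real.log t ^ 2 := by nlinarith
      nlinarith
  have := Real.exp_six_le
  rw [hconst] at hmono
  linarith

/-- The constant `1.77 = 1.18 * 3 / 2`: the derivative of `3 / 2 * t / log t ^ 2` is at least
`1 / log t ^ 2` once `6 ≤ log t`. The term `- 1320 / log x` will cancel the contribution of the
constant `1320` of `Chebyshev.theta_le_linear` to `θ x / log x`. -/
theorem integral_theta_div_from_exp_six_le {x : ℝ} (hx : Real.exp 6 ≤ x) :
    ∫ t in Real.exp 6..x, Chebyshev.theta t / (t * Real.log t ^ 2) ≤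
      1.77 * x / Real.log x ^ 2 - 1320 / Real.log x + 220 := by
  have h2 := Real.two_le_exp_six
  have hlog : ∀ t, Real.exp 6 ≤ t → 6 ≤ Real.log t := fun t ht =>
    (Real.le_log_iff_exp_le (by linarith)).2 ht
  have hder : ∀ t, Real.exp 6 ≤ t → HasDerivAt
      (fun t => 1.77 * t / Real.log t ^ 2 - 1320 / Real.log t)
      (1.77 / Real.log t ^ 2 - 3.54 / Real.log t ^ 3 + 1320 / (t * Real.log t ^ 2)) t := by
    intro t ht
    have ht0 : t ≠ 0 := by linarith
    have hl0 : Real.log t ≠ 0 := by linarith [hlog t ht]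
    have hl := Real.hasDerivAt_log ht0
    have h1 := ((hasDerivAt_id t).const_mul 1.77).div (hl.pow 2) (pow_ne_zero 2 hl0)
    have h3 := (hasDerivAt_const t (1320 : ℝ)).div hl hl0
    refine (h1.sub h3).congr_deriv ?_
    simp only [id_eq, Pi.pow_apply]
    field_simp
    ring
  have key := intervalIntegral.integral_le_sub_of_hasDeriv_right_of_le hx
    (g := fun t => 1.77 * t / Real.log t ^ 2 - 1320 / Real.log t)
    (φ := fun t => Chebyshev.theta t / (t * Real.log t ^ 2))
    (fun t ht => (hder t ht.1).continuousAt.continuousWithinAt)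
    (fun t ht => (hder t ht.1.le).hasDerivWithinAt)
    ((Chebyshev.integrableOn_theta_div_id_mul_log_sq x).mono_set (Set.Icc_subset_Icc_left h2))
    (fun t ht => by
      have ht0 : 0 < t := by linarith [ht.1]
      have hl6 := hlog t ht.1.le
      have hl0 : 0 < Real.log t := by linarith
      calc Chebyshev.theta t / (t * Real.log t ^ 2)
          ≤ (1.18 * t + 1320) / (t * Real.log t ^ 2) := by
            gcongr
            exact Chebyshev.theta_le_linear ht0.le
        _ = 1.18 / Real.log t ^ 2 + 1320 / (t * Real.log t ^ 2) := by field_simp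
        _ ≤ _ := by
          have e : 1.77 / Real.log t ^ 2 - 3.54 / Real.log t ^ 3 - 1.18 / Real.log t ^ 2 =
              0.59 * (Real.log t - 6) / Real.log t ^ 3 := by field_simp; ring
          have : 0 ≤ 0.59 * (Real.log t - 6) / Real.log t ^ 3 :=
            div_nonneg (mul_nonneg (by norm_num) (by linarith)) (by positivity)
          linarith)
  refine key.trans ?_
  simp only [Real.log_exp]
  have : 0 ≤ 1.77 * Real.exp 6 / 6 ^ 2 := by positivity
  linarith

theorem Nat.primeCounting_floor_le {x : ℝ} (hx : Real.exp 6 ≤ x) :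
    (Nat.primeCounting ⌊x⌋₊ : ℝ) ≤
      1.18 * x / Real.log x + 1.77 * x / Real.log x ^ 2 + 1390 := by
  have h2 := Real.two_le_exp_six
  have hlog : 6 ≤ Real.log x := (Real.le_log_iff_exp_le (by linarith)).2 hx
  have hI := Chebyshev.integrableOn_theta_div_id_mul_log_sq x
  rw [Chebyshev.primeCounting_eq_theta_div_log_add_integral (h2.trans hx),
    ← intervalIntegral.integral_add_adjacent_intervals (b := Real.exp 6)]
  · have h1 := integral_theta_div_exp_six_le
    have h3 := integral_theta_div_from_exp_six_le hx
    have h4 : Chebyshev.theta x / Real.log x ≤ (1.18 * x + 1320) / Real.log x := by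
      gcongr
      exact Chebyshev.theta_le_linear (by linarith)
    rw [add_div] at h4
    linarith
  · rw [intervalIntegrable_iff_integrableOn_Icc_of_le h2]
    exact hI.mono_set (Set.Icc_subset_Icc_right hx)
  · rw [intervalIntegrable_iff_integrableOn_Icc_of_le hx]
    exact hI.mono_set (Set.Icc_subset_Icc_left h2)

/-! ### An explicit lower bound for the totient -/

theorem Nat.nth_prime_pred_card_le {s : Finset ℕ} (hs : ∀ p ∈ s, p.Prime) {m : ℕ} (hm : m ∈ s)
    (hmax : ∀ p ∈ s, p ≤ m) : Nat.nth Nat.Prime (#s - 1) ≤ m := by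
  have h : #s - 1 ≤ Nat.count Nat.Prime m := by
    rw [Nat.count_eq_card_filter_range, ← card_erase_of_mem hm]
    refine card_le_card fun p hp => ?_
    obtain ⟨h1, h2⟩ := mem_erase.1 hp
    exact mem_filter.2 ⟨mem_range.2 (lt_of_le_of_ne (hmax p h2) h1), hs p h2⟩
  calc _ ≤ Nat.nth Nat.Prime (Nat.count Nat.Prime m) :=
        Nat.nth_monotone Nat.infinite_setOfPred_prime h
    _ = m := Nat.nth_count (hs m hm)

/-- Among all sets of `k` primes, the first `k` primes minimise the product of an increasing
nonnegative function. -/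
theorem Nat.prod_nth_prime_le_prod {f : ℕ → ℝ} (hf : ∀ a b : ℕ, 0 < a → a ≤ b → f a ≤ f b)
    (hf0 : ∀ a : ℕ, 0 < a → 0 ≤ f a) (k : ℕ) (s : Finset ℕ) (hs : ∀ p ∈ s, p.Prime) (hk : #s = k) :
    ∏ i ∈ range k, f (Nat.nth Nat.Prime i) ≤ ∏ p ∈ s, f p := by
  induction k generalizing s with
  | zero => simp [Finset.card_eq_zero.1 hk]
  | succ k ih =>
    have hne : s.Nonempty := Finset.card_pos.1 (by omega)
    have hm := s.max'_mem hne
    have h1 := Nat.nth_prime_pred_card_le hs hm fun p hp => s.le_max' p hp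
    rw [hk, Nat.add_sub_cancel] at h1
    rw [prod_range_succ, ← prod_erase_mul s _ hm]
    refine mul_le_mul (ih _ (fun p hp => hs p (mem_of_mem_erase hp)) ?_)
      (hf _ _ (Nat.prime_nth_prime k).pos h1) (hf0 _ (Nat.prime_nth_prime k).pos)
      (prod_nonneg fun p hp => hf0 p (hs p (mem_of_mem_erase hp)).pos)
    rw [card_erase_of_mem hm, hk, Nat.add_sub_cancel]

theorem one_sub_inv_natCast_mono (a b : ℕ) (ha : 0 < a) (hab : a ≤ b) :
    1 - (a : ℝ)⁻¹ ≤ 1 - (b : ℝ)⁻¹ := by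
  have : (0 : ℝ) < a := by exact_mod_cast ha
  gcongr

theorem one_sub_inv_natCast_nonneg (a : ℕ) (ha : 0 < a) : 0 ≤ 1 - (a : ℝ)⁻¹ :=
  sub_nonneg.2 (inv_le_one_of_one_le₀ (by exact_mod_cast ha))

theorem Nat.mul_prod_nth_prime_le_totient (n : ℕ) :
    n * ∏ i ∈ range #n.primeFactors, (1 - (Nat.nth Nat.Prime i : ℝ)⁻¹) ≤ Nat.totient n := by
  have h : (Nat.totient n : ℝ) = n * ∏ p ∈ n.primeFactors, (1 - (p : ℝ)⁻¹) := by
    have := congrArg (fun q : ℚ => (q : ℝ)) (Nat.totient_eq_mul_prod_factors n)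
    push_cast at this
    exact this
  rw [h]
  exact mul_le_mul_of_nonneg_left (Nat.prod_nth_prime_le_prod (f := fun a => 1 - (a : ℝ)⁻¹)
    one_sub_inv_natCast_mono one_sub_inv_natCast_nonneg _ _
    (fun p hp => Nat.prime_of_mem_primeFactors hp) rfl) (Nat.cast_nonneg _)

theorem Nat.prod_nth_prime_le {n : ℕ} (hn : n ≠ 0) :
    ∏ i ∈ range #n.primeFactors, (Nat.nth Nat.Prime i : ℝ) ≤ n := by
  refine (Nat.prod_nth_prime_le_prod (f := fun a => (a : ℝ)) (fun a b _ h => by exact_mod_cast h)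
    (fun a _ => Nat.cast_nonneg a) _ _ (fun p hp => Nat.prime_of_mem_primeFactors hp) rfl).trans ?_
  have := Nat.le_of_dvd (Nat.pos_of_ne_zero hn) (Nat.prod_primeFactors_dvd n)
  rw [← Nat.cast_prod]
  exact_mod_cast this

theorem Nat.nth_prime_values : Nat.nth Nat.Prime 0 = 2 ∧ Nat.nth Nat.Prime 1 = 3 ∧
    Nat.nth Nat.Prime 2 = 5 ∧ Nat.nth Nat.Prime 3 = 7 ∧ Nat.nth Nat.Prime 4 = 11 ∧
    Nat.nth Nat.Prime 5 = 13 ∧ Nat.nth Nat.Prime 6 = 17 ∧ Nat.nth Nat.Prime 7 = 19 :=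
  ⟨Nat.nth_count (p := Nat.Prime) (n := 2) (by norm_num),
    Nat.nth_count (p := Nat.Prime) (n := 3) (by norm_num),
    Nat.nth_count (p := Nat.Prime) (n := 5) (by norm_num),
    Nat.nth_count (p := Nat.Prime) (n := 7) (by norm_num),
    Nat.nth_count (p := Nat.Prime) (n := 11) (by norm_num),
    Nat.nth_count (p := Nat.Prime) (n := 13) (by norm_num),
    Nat.nth_count (p := Nat.Prime) (n := 17) (by norm_num),
    Nat.nth_count (p := Nat.Prime) (n := 19) (by norm_num)⟩

theorem Real.natCast_le_log_of_pow_le {k : ℕ} {x : ℝ} (h : (2.7182818286 : ℝ) ^ k ≤ x) :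
    (k : ℝ) ≤ Real.log x := by
  have hx : 0 < x := lt_of_lt_of_le (by positivity) h
  rw [Real.le_log_iff_exp_le hx, ← mul_one (k : ℝ), Real.exp_nat_mul]
  exact (pow_le_pow_left₀ (Real.exp_pos _).le Real.exp_one_lt_d9.le _).trans h

theorem Nat.prod_nth_prime_le_pow (k : ℕ) :
    ∏ i ∈ range k, (Nat.nth Nat.Prime i : ℝ) ≤ (Nat.nth Nat.Prime k : ℝ) ^ k := by
  calc _ ≤ ∏ _i ∈ range k, (Nat.nth Nat.Prime k : ℝ) := by
        refine prod_le_prod (fun _ _ => Nat.cast_nonneg _) fun i hi => ?_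
        exact_mod_cast Nat.nth_monotone Nat.infinite_setOfPred_prime (mem_range.1 hi).le
    _ = _ := by simp

/-- For `P` the product of the first `k` primes, `φ(P) / P * log P` increases with `k`: passing to
the next prime `p` increases it as soon as `log P ≤ (p - 1) * log p`, and `P ≤ p ^ k` with
`k < p`. -/
theorem le_prod_one_sub_inv_mul_log_prod {k : ℕ} (hk : 8 ≤ k) :
    (2.73 : ℝ) ≤ (∏ i ∈ range k, (1 - (Nat.nth Nat.Prime i : ℝ)⁻¹)) *
      Real.log (∏ i ∈ range k, (Nat.nth Nat.Prime i : ℝ)) := by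
  induction k, hk using Nat.le_induction with
  | base =>
    obtain ⟨h0, h1, h2, h3, h4, h5, h6, h7⟩ := Nat.nth_prime_values
    simp only [prod_range_succ, prod_range_zero, h0, h1, h2, h3, h4, h5, h6, h7]
    have h : ((16 : ℕ) : ℝ) ≤ Real.log (1 * ((2 : ℕ) : ℝ) * ((3 : ℕ) : ℝ) * ((5 : ℕ) : ℝ) *
        ((7 : ℕ) : ℝ) * ((11 : ℕ) : ℝ) * ((13 : ℕ) : ℝ) * ((17 : ℕ) : ℝ) * ((19 : ℕ) : ℝ)) :=
      Real.natCast_le_log_of_pow_le (by norm_num)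
    refine le_trans ?_ (mul_le_mul_of_nonneg_left h (by norm_num))
    norm_num
  | succ k _ ih =>
    refine ih.trans ?_
    have hP : 0 < ∏ i ∈ range k, (Nat.nth Nat.Prime i : ℝ) :=
      prod_pos fun i _ => by exact_mod_cast (Nat.prime_nth_prime i).pos
    have hp1 : (1 : ℝ) < Nat.nth Nat.Prime k := by exact_mod_cast (Nat.prime_nth_prime k).one_lt
    rw [prod_range_succ, prod_range_succ, Real.log_mul hP.ne' (by positivity), mul_assoc]
    refine mul_le_mul_of_nonneg_left ?_ (prod_nonneg fun i _ =>
      one_sub_inv_natCast_nonneg _ (Nat.prime_nth_prime i).pos)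
    have hlog : Real.log (∏ i ∈ range k, (Nat.nth Nat.Prime i : ℝ)) ≤
        k * Real.log (Nat.nth Nat.Prime k) := by
      rw [← Real.log_pow]
      exact Real.log_le_log hP (Nat.prod_nth_prime_le_pow k)
    have hkp : (k : ℝ) + 2 ≤ Nat.nth Nat.Prime k := by
      exact_mod_cast Nat.add_two_le_nth_prime k
    have hlp := Real.log_pos hp1
    set p : ℝ := ((Nat.nth Nat.Prime k : ℕ) : ℝ)
    set a := Real.log (∏ i ∈ range k, (Nat.nth Nat.Prime i : ℝ))
    have : 0 ≤ ((p - 1) * Real.log p - a) * p⁻¹ := by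
      refine mul_nonneg ?_ (by positivity)
      nlinarith
    have e : (1 - p⁻¹) * (a + Real.log p) - a = ((p - 1) * Real.log p - a) * p⁻¹ := by
      field_simp
      ring
    linarith

theorem Real.log_three_million_ge : (14.9 : ℝ) ≤ Real.log 3000000 := by
  have h : ((149 : ℕ) : ℝ) ≤ Real.log (3000000 ^ 10) :=
    Real.natCast_le_log_of_pow_le (by norm_num)
  rw [Real.log_pow] at h
  norm_num at h ⊢
  linarith

theorem Nat.totient_mul_log_ge {n : ℕ} (hn : 3000000 ≤ n) :
    2.68 * (n : ℝ) ≤ Nat.totient n * Real.log n := by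
  have hnR : (3000000 : ℝ) ≤ n := by exact_mod_cast hn
  have hlog : 14.9 ≤ Real.log n :=
    Real.log_three_million_ge.trans (Real.log_le_log (by norm_num) hnR)
  have htot := Nat.mul_prod_nth_prime_le_totient n
  have hprod := Nat.prod_nth_prime_le (n := n) (by omega)
  have hnn : ∀ i, 0 ≤ 1 - (Nat.nth Nat.Prime i : ℝ)⁻¹ := fun i =>
    one_sub_inv_natCast_nonneg _ (Nat.prime_nth_prime i).pos
  generalize #n.primeFactors = k at htot hprod
  suffices h : 2.68 ≤ (∏ i ∈ range k, (1 - (Nat.nth Nat.Prime i : ℝ)⁻¹)) * Real.log n by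
    calc 2.68 * (n : ℝ) ≤ (∏ i ∈ range k, (1 - (Nat.nth Nat.Prime i : ℝ)⁻¹)) * Real.log n * n := by
          gcongr
      _ = (n * ∏ i ∈ range k, (1 - (Nat.nth Nat.Prime i : ℝ)⁻¹)) * Real.log n := by ring
      _ ≤ _ := mul_le_mul_of_nonneg_right htot (by linarith)
  rcases lt_or_ge k 8 with hk | hk
  · have h1 : ∏ i ∈ range 7, (1 - (Nat.nth Nat.Prime i : ℝ)⁻¹) ≤
        ∏ i ∈ range k, (1 - (Nat.nth Nat.Prime i : ℝ)⁻¹) :=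
      prod_le_prod_of_subset_of_le_one (range_mono (by omega)) (fun i _ => hnn i)
        fun i _ => by simp
    have h2 : (0.1805 : ℝ) ≤ ∏ i ∈ range 7, (1 - (Nat.nth Nat.Prime i : ℝ)⁻¹) := by
      obtain ⟨h0, h1, h2, h3, h4, h5, h6, -⟩ := Nat.nth_prime_values
      simp only [prod_range_succ, prod_range_zero, h0, h1, h2, h3, h4, h5, h6]
      norm_num
    calc (2.68 : ℝ) ≤ 0.1805 * 14.9 := by norm_num
      _ ≤ _ := mul_le_mul (h2.trans h1) hlog (by norm_num) (prod_nonneg fun i _ => hnn i)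
  · have h1 := le_prod_one_sub_inv_mul_log_prod hk
    have h2 := mul_le_mul_of_nonneg_left (Real.log_le_log (prod_pos fun i _ => by
      exact_mod_cast (Nat.prime_nth_prime i).pos) hprod)
      (prod_nonneg (s := range k) fun i _ => hnn i)
    linarith

/-! ### Integers coprime to an even number -/

theorem Real.log_le_div_two_hundred_thousand {x : ℝ} (hx : 3000000 ≤ x) :
    Real.log x ≤ x / 200000 := by
  have h15 : Real.log 3000000 ≤ 15 := by
    rw [Real.log_le_iff_le_exp (by norm_num)]
    have h : Real.exp 15 = Real.exp 1 ^ 15 := by rw [← Real.exp_nat_mul]; norm_num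
    rw [h]
    exact le_trans (by norm_num) (pow_le_pow_left₀ (by norm_num) Real.exp_one_gt_d9.le 15)
  have h := Real.log_le_sub_one_of_pos (show 0 < x / 3000000 by positivity)
  rw [Real.log_div (by linarith) (by norm_num)] at h
  linarith

theorem Nat.two_mul_primeCounting_lt_totient {n : ℕ} (hn : 3000000 ≤ n) :
    2 * Nat.primeCounting n < Nat.totient n := by
  have hnR : (3000000 : ℝ) ≤ n := by exact_mod_cast hn
  have hlog : 14.9 ≤ Real.log n :=
    Real.log_three_million_ge.trans (Real.log_le_log (by norm_num) hnR)
  have hl0 : 0 < Real.log n := by linarith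
  have hpi := Nat.primeCounting_floor_le (x := n) (Real.exp_six_le.trans (by linarith))
  rw [Nat.floor_natCast] at hpi
  have htot := Nat.totient_mul_log_ge hn
  have hsmall := Real.log_le_div_two_hundred_thousand hnR
  have h1 : Nat.primeCounting n * Real.log n ≤
      1.18 * n + 1.77 * n / Real.log n + 1390 * Real.log n := by
    refine (mul_le_mul_of_nonneg_right hpi hl0.le).trans_eq ?_
    field_simp
  -- `1.18 + 0.119 + 1390 / 200000 < 1.34 = 2.68 / 2`.
  have h2 : 1.77 * n / Real.log n ≤ 0.119 * n := by
    rw [div_le_iff₀ hl0]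
    nlinarith
  have h3 : (2 * Nat.primeCounting n : ℝ) * Real.log n < Nat.totient n * Real.log n := by
    linarith
  exact_mod_cast lt_of_mul_lt_mul_right h3 hl0.le

open Goldbach in
/-- An integer in `[1, n)` coprime to `n` is `1`, `n - 1`, a prime of type P or a composite of
type P: for even `n`, `n - 2` is not coprime to `n`. -/
theorem Goldbach.totient_le_ncard_add_ncard {n : ℕ} (hn : 4 ≤ n) (hev : Even n) :
    Nat.totient n ≤ (primesOfTypeP n).ncard + (compositesOfTypeP n).ncard + 2 := by
  have hP := primesOfTypeP_finite n
  have hX := compositesOfTypeP_finite n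
  have hsub : (↑({a ∈ range n | n.Coprime a}) : Set ℕ) ⊆
      (primesOfTypeP n ∪ compositesOfTypeP n) ∪ {1, n - 1} := by
    intro a ha
    simp only [coe_filter, mem_range, Set.mem_ofPred_eq] at ha
    obtain ⟨han, hc⟩ := ha
    by_cases h1 : a = 1
    · simp [h1]
    by_cases h2 : a = n - 1
    · simp [h2]
    have h0 : a ≠ 0 := by
      rintro rfl
      rw [Nat.coprime_zero_right] at hc
      omega
    have h3 : a ≠ n - 2 := by
      rintro rfl
      have : 2 ∣ Nat.gcd n (n - 2) :=
        Nat.dvd_gcd hev.two_dvd (Nat.dvd_sub hev.two_dvd (dvd_refl 2))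
      rw [hc] at this
      omega
    have hlt : a < n - 2 := by omega
    have hprime : ∀ p : ℕ, p.Prime → p ∣ a → IsPrimeOfTypeP n p := fun p hp hpa =>
      ⟨hp, (Nat.le_of_dvd (Nat.pos_of_ne_zero h0) hpa).trans_lt hlt, fun hpn =>
        hp.one_lt.ne' (Nat.eq_one_of_dvd_coprimes hc hpn hpa)⟩
    refine Or.inl ?_
    by_cases hap : a.Prime
    · exact Or.inl (hprime a hap dvd_rfl)
    · exact Or.inr ⟨⟨by omega, hap⟩, hlt, hprime⟩
  rw [Nat.totient_eq_card_coprime, ← Set.ncard_coe_finset]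
  calc _ ≤ ((primesOfTypeP n ∪ compositesOfTypeP n) ∪ {1, n - 1}).ncard :=
        Set.ncard_le_ncard hsub ((hP.union hX).union (Set.toFinite _))
    _ ≤ (primesOfTypeP n ∪ compositesOfTypeP n).ncard + ({1, n - 1} : Set ℕ).ncard :=
        Set.ncard_union_le _ _
    _ ≤ _ := add_le_add (Set.ncard_union_le _ _) ((Set.ncard_insert_le _ _).trans (by simp))

open Goldbach in
theorem Goldbach.ncard_primesOfTypeP_lt {n : ℕ} (hn : 2 ≤ n) (hev : Even n) :
    (primesOfTypeP n).ncard < Nat.primeCounting n := by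
  rw [← Nat.primesLE_card_eq_primeCounting, ← Set.ncard_coe_finset]
  refine Set.ncard_lt_ncard ⟨fun p hp => ?_, fun h => ?_⟩ (finite_toSet _)
  · exact mem_coe.2 (Nat.mem_primesLE.2 ⟨by have := hp.2.1; omega, hp.1⟩)
  · -- The prime `2` divides `n`.
    have h2 : 2 ∈ primesOfTypeP n := h (mem_coe.2 (Nat.mem_primesLE.2 ⟨hn, Nat.prime_two⟩))
    exact h2.2.2 hev.two_dvd

theorem mainTheorem3 (N : ℕ) (hN : 3 * 10 ^ 6 ≤ 2 * N) :
    (Goldbach.primesOfTypeP (2 * N)).ncard < (Goldbach.compositesOfTypeP (2 * N)).ncard := by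
  have hev : Even (2 * N) := even_two_mul N
  have h1 := Goldbach.totient_le_ncard_add_ncard (by omega) hev
  have h2 := Goldbach.ncard_primesOfTypeP_lt (by omega) hev
  have h3 := Nat.two_mul_primeCounting_lt_totient (n := 2 * N) (by omega)
  omega
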